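/- Let $k$ be an algebraically closed field, $B$ a finite dimensional $k$-algebra, $P_0$ a finitely generated projective left $B$-module, and let $A=B[P_0]=\begin{pmatrix}B&P_0\\0&k\end{pmatrix}$ be the one-point extension of $B$ by $P_0$. All modules are left modules, not necessarily finitely generated. Let $e_B=\begin{pmatrix}1&0\\0&0\end{pmatrix}$, let $\mathcal R=\mathrm{Hom}_A(Ae_B,-)$ from $A$-modules to $B$-modules be the restriction functor and $\mathcal E=\mathrm{Hom}_B(e_BA,-)$ from $B$-modules to $A$-modules the extension functor. Let $S$ be the simple top of the projective $A$-module $Ae$, $e=\begin{pmatrix}0&0\\0&1\end{pmatrix}$; that is, $S=k$ with $A$ acting through the projection $A\to k$. Put $$S^{\mathrm{perp}}=\{X\in \mathrm{Mod}\text{-}A : \mathrm{Hom}_A(S,X)=0=\mathrm{Ext}^1_A(S,X)\}.$$ For a ring $R$ and an $R$-module $T$, let $\mathrm{Cogen}(T)$ be the class of modules that embed into a direct product of copies of $T$. An injective copresentation of $T$ is an exact sequence $0\to T\xrightarrow{\iota}E_0\xrightarrow{\zeta}E_1$ with $E_0,E_1$ injective. Let $\mathcal B_\zeta$ be the class of modules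 $M$ such that $\mathrm{Hom}_R(M,\zeta):\mathrm{Hom}_R(M,E_0)\to\mathrm{Hom}_R(M,E_1)$ is surjective. The module $T$ is cosilting with respect to this injective copresentation if $\mathrm{Cogen}(T)=\mathcal B_\zeta$, and $T$ is cosilting if it is so with respect to some injective copresentation. Then: 1. If $C\in S^{\mathrm{perp}}$ is a cosilting $A$-module, then $\mathcal R C$ is a cosilting $B$-module. 2. If $C'$ is a cosilting $B$-module, then $\mathcal E C'\oplus S$ is a cosilting $A$-module. More precisely, if $C'$ is cosilting with respect to the injective copresentation $0\to C'\xrightarrow{\iota}E_0\xrightarrow{\zeta}E_1$, then $\mathcal E C'\oplus S$ is cosilting with respect to the injective copresentation $$0\to \mathcal E C'\oplus S\xrightarrow{\ \mathcal E\iota\oplus 1_S\ }\mathcal E E_0\oplus S\xrightarrow{\ (\mathcal E\zeta\ \ 0)\ }\mathcal E E_1 .$$ -/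

import Mathlib

universe u

set_option linter.unusedSectionVars false
set_option linter.unusedVariables false

namespace CosiltingExt

/-! ### Cosilting modules over an arbitrary ring (all modules are left modules) -/

section Cosilting

variable (R : Type u) [Ring R]

/-- `M ∈ Cogen(T)`: the module `M` embeds into a direct product of copies of `T`. -/
def MemCogen (T M : Type u) [AddCommGroup T] [Module R T] [AddCommGroup M] [Module R M] : Prop :=
  ∃ (I : Type u) (f : M →ₗ[R] (I → T)), Function.Injective f

variable {R}

/-- `M ∈ 𝓑_ζ`: the induced map `Hom_R(M, ζ) : Hom_R(M, E₀) → Hom_R(M, E₁)` is surjective. -/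
def MemB {E₀ E₁ : Type u} [AddCommGroup E₀] [Module R E₀] [AddCommGroup E₁] [Module R E₁]
    (ζ : E₀ →ₗ[R] E₁) (M : Type u) [AddCommGroup M] [Module R M] : Prop :=
  Function.Surjective (fun f : M →ₗ[R] E₀ => ζ.comp f)

/-- `0 → T → E₀ → E₁`, with maps `ι` and `ζ`, is an injective copresentation of `T`: it is exact, and `E₀`, `E₁`
are injective modules. -/
structure IsInjCopresentation {T E₀ E₁ : Type u} [AddCommGroup T] [Module R T]
    [AddCommGroup E₀] [Module R E₀] [AddCommGroup E₁] [Module R E₁]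
    (ι : T →ₗ[R] E₀) (ζ : E₀ →ₗ[R] E₁) : Prop where
  injective₀ : Module.Injective R E₀
  injective₁ : Module.Injective R E₁
  mono : Function.Injective ι
  exact : Function.Exact ι ζ

/-- `T` is cosilting with respect to the injective copresentation `0 → T → E₀ → E₁` given by `ι` and `ζ`:
moreover `Cogen(T) = 𝓑_ζ`. -/
structure IsCosiltingWith {T E₀ E₁ : Type u} [AddCommGroup T] [Module R T]
    [AddCommGroup E₀] [Module R E₀] [AddCommGroup E₁] [Module R E₁]
    (ι : T →ₗ[R] E₀) (ζ : E₀ →ₗ[R] E₁) : Prop where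
  copresentation : IsInjCopresentation ι ζ
  cogen_iff : ∀ (M : Type u) [AddCommGroup M] [Module R M], MemCogen R T M ↔ MemB ζ M

variable (R)

/-- `T` is a cosilting `R`-module. -/
def IsCosilting (T : Type u) [AddCommGroup T] [Module R T] : Prop :=
  ∃ (E₀ E₁ : Type u) (_ : AddCommGroup E₀) (_ : Module R E₀) (_ : AddCommGroup E₁)
    (_ : Module R E₁) (ι : T →ₗ[R] E₀) (ζ : E₀ →ₗ[R] E₁), IsCosiltingWith ι ζ

/-- `X` lies in the right perpendicular category of `S`: `Hom_R(S, X) = 0 = Ext¹_R(S, X)`. -/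
def MemPerp (S X : Type u) [AddCommGroup S] [Module R S] [AddCommGroup X] [Module R X] : Prop :=
  (∀ f : S →ₗ[R] X, f = 0) ∧
    Subsingleton (CategoryTheory.Abelian.Ext (ModuleCat.of R S) (ModuleCat.of R X) 1)

end Cosilting

/-! ### The one-point extension -/

/-- The one-point extension `A = B[P₀]`: upper triangular matrices `(b p; 0 c)` with
`b ∈ B`, `p ∈ P₀`, `c ∈ k`. -/
@[ext]
structure OnePointExt (k B P₀ : Type u) where
  b : B
  p : P₀
  c : k

namespace OnePointExt

variable {k B P₀ : Type u} [Field k] [Ring B] [Algebra k B] [AddCommGroup P₀] [Module B P₀]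

instance : Zero (OnePointExt k B P₀) := ⟨⟨0, 0, 0⟩⟩
instance : One (OnePointExt k B P₀) := ⟨⟨1, 0, 1⟩⟩
instance : Add (OnePointExt k B P₀) := ⟨fun x y => ⟨x.b + y.b, x.p + y.p, x.c + y.c⟩⟩
instance : Neg (OnePointExt k B P₀) := ⟨fun x => ⟨-x.b, -x.p, -x.c⟩⟩

/-- Matrix multiplication; a scalar `c ∈ k` acts on `P₀` through `k → B`. -/
instance : Mul (OnePointExt k B P₀) :=
  ⟨fun x y => ⟨x.b * y.b, x.b • y.p + algebraMap k B y.c • x.p, x.c * y.c⟩⟩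

@[simp] theorem zero_b : (0 : OnePointExt k B P₀).b = 0 := rfl
@[simp] theorem zero_p : (0 : OnePointExt k B P₀).p = 0 := rfl
@[simp] theorem zero_c : (0 : OnePointExt k B P₀).c = 0 := rfl
@[simp] theorem one_b : (1 : OnePointExt k B P₀).b = 1 := rfl
@[simp] theorem one_p : (1 : OnePointExt k B P₀).p = 0 := rfl
@[simp] theorem one_c : (1 : OnePointExt k B P₀).c = 1 := rfl
@[simp] theorem add_b (x y : OnePointExt k B P₀) : (x + y).b = x.b + y.b := rfl
@[simp] theorem add_p (x y : OnePointExt k B P₀) : (x + y).p = x.p + y.p := rfl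
@[simp] theorem add_c (x y : OnePointExt k B P₀) : (x + y).c = x.c + y.c := rfl
@[simp] theorem neg_b (x : OnePointExt k B P₀) : (-x).b = -x.b := rfl
@[simp] theorem neg_p (x : OnePointExt k B P₀) : (-x).p = -x.p := rfl
@[simp] theorem neg_c (x : OnePointExt k B P₀) : (-x).c = -x.c := rfl
@[simp] theorem mul_b (x y : OnePointExt k B P₀) : (x * y).b = x.b * y.b := rfl
@[simp] theorem mul_p (x y : OnePointExt k B P₀) :
    (x * y).p = x.b • y.p + algebraMap k B y.c • x.p := rfl
@[simp] theorem mul_c (x y : OnePointExt k B P₀) : (x * y).c = x.c * y.c := rfl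

instance : Ring (OnePointExt k B P₀) where
  add_assoc x y z := by ext <;> simp [add_assoc]
  zero_add x := by ext <;> simp
  add_zero x := by ext <;> simp
  add_comm x y := by ext <;> simp [add_comm]
  neg_add_cancel x := by ext <;> simp
  left_distrib x y z := by
    ext
    · simp [mul_add]
    · simp only [mul_p, add_p, add_c, smul_add, map_add, add_smul]; abel
    · simp [mul_add]
  right_distrib x y z := by
    ext
    · simp [add_mul]
    · simp only [mul_p, add_p, add_b, smul_add, add_smul]; abel
    · simp [add_mul]
  zero_mul x := by ext <;> simp
  mul_zero x := by ext <;> simp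
  mul_assoc x y z := by
    ext
    · simp [mul_assoc]
    · simp only [mul_p, mul_b, mul_c, smul_add, ← mul_smul]
      rw [← Algebra.commutes z.c x.b, ← map_mul, mul_comm z.c y.c, add_assoc]
    · simp [mul_assoc]
  one_mul x := by ext <;> simp
  mul_one x := by ext <;> simp
  nsmul := nsmulRec
  zsmul := zsmulRec

variable (k P₀) in
/-- The diagonal copy `(b 0; 0 0)` of `b ∈ B`. -/
def ofB (b : B) : OnePointExt k B P₀ := ⟨b, 0, 0⟩

@[simp] theorem ofB_b (b : B) : (ofB k P₀ b).b = b := rfl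
@[simp] theorem ofB_p (b : B) : (ofB k P₀ b).p = 0 := rfl
@[simp] theorem ofB_c (b : B) : (ofB k P₀ b).c = 0 := rfl

variable (k B P₀)

/-- The idempotent `e_B`, the identity of `B` seen in `A`. -/
def eB : OnePointExt k B P₀ := ofB k P₀ 1

/-- The left ideal `A e_B` of `A`. -/
abbrev AeB : Submodule (OnePointExt k B P₀) (OnePointExt k B P₀) := Ideal.span {eB k B P₀}

/-- The right ideal `e_B A` of `A`, as an additive group. -/
abbrev eBA : AddSubgroup (OnePointExt k B P₀) := (AddMonoidHom.mulLeft (eB k B P₀)).range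

variable {k B P₀}

theorem ofB_mul_ofB (b b' : B) : ofB k P₀ b * ofB k P₀ b' = ofB k P₀ (b * b') := by
  ext <;> simp

theorem eB_mul_ofB (b : B) : eB k B P₀ * ofB k P₀ b = ofB k P₀ b := by ext <;> simp [eB]

theorem ofB_mul_eB (b : B) : ofB k P₀ b * eB k B P₀ = ofB k P₀ b := by ext <;> simp [eB]

theorem mem_AeB {x : OnePointExt k B P₀} : x ∈ AeB k B P₀ ↔ x * eB k B P₀ = x := by
  rw [Ideal.mem_span_singleton']
  refine ⟨?_, fun h => ⟨x, h⟩⟩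
  rintro ⟨a, rfl⟩
  rw [mul_assoc, eB, ofB_mul_ofB, mul_one]

theorem mem_eBA {x : OnePointExt k B P₀} : x ∈ eBA k B P₀ ↔ eB k B P₀ * x = x := by
  refine ⟨?_, fun h => ⟨x, h⟩⟩
  rintro ⟨a, rfl⟩
  rw [AddMonoidHom.coe_mulLeft, ← mul_assoc, eB, ofB_mul_ofB, mul_one]

/-- The right action of `b ∈ B` on `A e_B`, as an endomorphism of the left `A`-module `A e_B`. -/
def AeB.rightMul (b : B) : AeB k B P₀ →ₗ[OnePointExt k B P₀] AeB k B P₀ where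
  toFun x := ⟨x.1 * ofB k P₀ b, mem_AeB.2 (by rw [mul_assoc, ofB_mul_eB])⟩
  map_add' x y := Subtype.ext (add_mul _ _ _)
  map_smul' a x := Subtype.ext (mul_assoc _ _ _)

/-- The left `B`-module structure on `e_B A`. -/
instance : Module B (eBA k B P₀) where
  smul b x := ⟨ofB k P₀ b * x.1, mem_eBA.2 (by rw [← mul_assoc, eB_mul_ofB])⟩
  one_smul x := Subtype.ext (mem_eBA.1 x.2)
  mul_smul b b' x := Subtype.ext <| by
    change ofB k P₀ (b * b') * x.1 = ofB k P₀ b * (ofB k P₀ b' * x.1)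
    rw [← mul_assoc]; congr 1; ext <;> simp
  smul_zero b := Subtype.ext (mul_zero _)
  smul_add b x y := Subtype.ext (mul_add _ _ _)
  add_smul b b' x := Subtype.ext <| by
    change ofB k P₀ (b + b') * x.1 = ofB k P₀ b * x.1 + ofB k P₀ b' * x.1
    rw [← add_mul]; congr 1; ext <;> simp
  zero_smul x := Subtype.ext <| by
    change ofB k P₀ 0 * x.1 = 0
    ext <;> simp

theorem coe_smul_eBA (b : B) (x : eBA k B P₀) :
    ((b • x : eBA k B P₀) : OnePointExt k B P₀) = ofB k P₀ b * x := rfl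

/-- The right action of `a ∈ A` on `e_B A`, as an endomorphism of the left `B`-module `e_B A`. -/
def eBA.rightMul (a : OnePointExt k B P₀) : eBA k B P₀ →ₗ[B] eBA k B P₀ where
  toFun x := ⟨x.1 * a, mem_eBA.2 (by rw [← mul_assoc, mem_eBA.1 x.2])⟩
  map_add' x y := Subtype.ext (add_mul _ _ _)
  map_smul' b x := Subtype.ext (mul_assoc _ _ _)

end OnePointExt

open OnePointExt

variable (k B P₀ : Type u) [Field k] [Ring B] [Algebra k B] [AddCommGroup P₀] [Module B P₀]

/-! ### The restriction and extension functors -/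

/-- The restriction `𝓡 X = Hom_A(A e_B, X)` of an `A`-module `X`. -/
def Restr (X : Type u) [AddCommGroup X] [Module (OnePointExt k B P₀) X] : Type u :=
  AeB k B P₀ →ₗ[OnePointExt k B P₀] X

/-- The extension `𝓔 M = Hom_B(e_B A, M)` of a `B`-module `M`. -/
def Extn (M : Type u) [AddCommGroup M] [Module B M] : Type u :=
  eBA k B P₀ →ₗ[B] M

instance (X : Type u) [AddCommGroup X] [Module (OnePointExt k B P₀) X] :
    AddCommGroup (Restr k B P₀ X) :=
  inferInstanceAs (AddCommGroup (AeB k B P₀ →ₗ[OnePointExt k B P₀] X))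

instance (M : Type u) [AddCommGroup M] [Module B M] : AddCommGroup (Extn k B P₀ M) :=
  inferInstanceAs (AddCommGroup (eBA k B P₀ →ₗ[B] M))

/-- The `B`-module structure on `𝓡 X`: `(b f)(x) = f(x b)`. -/
instance (X : Type u) [AddCommGroup X] [Module (OnePointExt k B P₀) X] :
    Module B (Restr k B P₀ X) where
  smul b f := LinearMap.comp (M₂ := AeB k B P₀) f (AeB.rightMul b)
  one_smul f := LinearMap.ext fun x => congrArg (DFunLike.coe (F := _ →ₗ[_] X) f)
    (Subtype.ext (mem_AeB.1 x.2))
  mul_smul b b' f := LinearMap.ext fun x => congrArg (DFunLike.coe (F := _ →ₗ[_] X) f) <|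
    Subtype.ext <| by
      change x.1 * ofB k P₀ (b * b') = x.1 * ofB k P₀ b * ofB k P₀ b'
      rw [mul_assoc]; congr 1; ext <;> simp
  smul_zero b := LinearMap.zero_comp _
  smul_add b f g := LinearMap.add_comp _ _ _
  add_smul b b' f := LinearMap.ext fun x =>
    (congrArg (DFunLike.coe (F := _ →ₗ[_] X) f) <| Subtype.ext <| by
      change x.1 * ofB k P₀ (b + b') = x.1 * ofB k P₀ b + x.1 * ofB k P₀ b'
      rw [← mul_add]; congr 1; ext <;> simp).trans (LinearMap.map_add _ _ _)
  zero_smul f := LinearMap.ext fun x =>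
    (congrArg (DFunLike.coe (F := _ →ₗ[_] X) f) <| Subtype.ext <| by
      change x.1 * ofB k P₀ 0 = 0
      ext <;> simp).trans (LinearMap.map_zero _)

/-- The `A`-module structure on `𝓔 M`: `(a f)(x) = f(x a)`. -/
instance (M : Type u) [AddCommGroup M] [Module B M] :
    Module (OnePointExt k B P₀) (Extn k B P₀ M) where
  smul a f := LinearMap.comp (M₂ := eBA k B P₀) f (eBA.rightMul a)
  one_smul f := LinearMap.ext fun x => congrArg (DFunLike.coe (F := _ →ₗ[_] M) f)
    (Subtype.ext (mul_one _))
  mul_smul a a' f := LinearMap.ext fun x => congrArg (DFunLike.coe (F := _ →ₗ[_] M) f)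
    (Subtype.ext (mul_assoc _ _ _).symm)
  smul_zero a := LinearMap.zero_comp _
  smul_add a f g := LinearMap.add_comp _ _ _
  add_smul a a' f := LinearMap.ext fun x =>
    (congrArg (DFunLike.coe (F := _ →ₗ[_] M) f) (Subtype.ext (mul_add _ _ _))).trans
      (LinearMap.map_add _ _ _)
  zero_smul f := LinearMap.ext fun x =>
    (congrArg (DFunLike.coe (F := _ →ₗ[_] M) f) (Subtype.ext (mul_zero _))).trans
      (LinearMap.map_zero _)

variable {B} in
/-- The functor `𝓔` on morphisms: composition with `g`. -/
def Extn.map {M N : Type u} [AddCommGroup M] [Module B M] [AddCommGroup N] [Module B N]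
    (g : M →ₗ[B] N) : Extn k B P₀ M →ₗ[OnePointExt k B P₀] Extn k B P₀ N where
  toFun f := LinearMap.comp (M₂ := M) g f
  map_add' f f' := LinearMap.comp_add _ _ _
  map_smul' _ _ := rfl

/-! ### The simple module `S` -/

variable {k B P₀} in
/-- The ring homomorphism `A → k`, `(b p; 0 c) ↦ c`. -/
def OnePointExt.toField : OnePointExt k B P₀ →+* k where
  toFun x := x.c
  map_one' := rfl
  map_mul' _ _ := rfl
  map_zero' := rfl
  map_add' _ _ := rfl

/-- The simple `A`-module `S` of the extension vertex: `k`, on which `A` acts through `A → k`.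
By `simpleS_is_top` below it is the top of `P̃ = A e`, where `e = (0 0; 0 1)`. -/
@[nolint unusedArguments]
def SimpleS (k B P₀ : Type u) [Field k] [Ring B] [Algebra k B] [AddCommGroup P₀] [Module B P₀] :
    Type u := k

instance : AddCommGroup (SimpleS k B P₀) := inferInstanceAs (AddCommGroup k)

instance : Module (OnePointExt k B P₀) (SimpleS k B P₀) :=
  Module.compHom k (OnePointExt.toField (k := k) (B := B) (P₀ := P₀))

/-- The indecomposable projective `P̃ = A e`, with `e = (0 0; 0 1)`. -/
abbrev Ptilde : Submodule (OnePointExt k B P₀) (OnePointExt k B P₀) := Ideal.span {⟨0, 0, 1⟩}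

/-- The canonical map `P̃ → S`, `x ↦ c`. -/
def Ptilde.toS : Ptilde k B P₀ →ₗ[OnePointExt k B P₀] SimpleS k B P₀ where
  toFun x := (x.1.c : k)
  map_add' _ _ := rfl
  map_smul' _ _ := rfl

/-- `S` is the top of `P̃`: the canonical map `P̃ → S` is onto with kernel the radical of `P̃`. -/
theorem simpleS_is_top : Function.Surjective (Ptilde.toS k B P₀) ∧
    LinearMap.ker (Ptilde.toS k B P₀) = Module.jacobson (OnePointExt k B P₀) (Ptilde k B P₀) := by
  let e : Ptilde k B P₀ := ⟨⟨0, 0, 1⟩, Ideal.mem_span_singleton_self _⟩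
  have he : ∀ x : OnePointExt k B P₀, ∀ y : Ptilde k B P₀, x = y.1 → x • e = y := by
    rintro _ ⟨y, hy⟩ rfl
    obtain ⟨a, rfl⟩ := Ideal.mem_span_singleton'.1 hy
    apply Subtype.ext
    change a * (⟨0, 0, 1⟩ : OnePointExt k B P₀) * (⟨0, 0, 1⟩ : OnePointExt k B P₀) =
      a * (⟨0, 0, 1⟩ : OnePointExt k B P₀)
    ext <;> simp
  have hsurj : Function.Surjective (Ptilde.toS k B P₀) := fun c => by
    refine ⟨(⟨0, 0, c⟩ : OnePointExt k B P₀) • e, ?_⟩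
    exact mul_one (M := k) c
  refine ⟨hsurj, le_antisymm (le_sInf fun N hN => ?_) (sInf_le ?_)⟩
  · by_contra hle
    have htop : N ⊔ LinearMap.ker (Ptilde.toS k B P₀) = ⊤ :=
      hN.2 _ (left_lt_sup.2 hle)
    have hmem : e ∈ N ⊔ LinearMap.ker (Ptilde.toS k B P₀) := htop ▸ Submodule.mem_top
    obtain ⟨n, hn, x, hx, hnx⟩ := Submodule.mem_sup.1 hmem
    have hxc : x.1.c = 0 := hx
    have hx0 : e.1 • x = 0 := by
      apply Subtype.ext
      change (⟨0, 0, 1⟩ : OnePointExt k B P₀) * x.1 = 0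
      ext <;> simp [hxc]
    have hen : e ∈ N := by
      have h1 : e.1 • n + e.1 • x = e.1 • e := by rw [← smul_add, hnx]
      rw [hx0, add_zero, he e.1 e rfl] at h1
      exact h1 ▸ N.smul_mem _ hn
    refine hN.1 (eq_top_iff.2 fun y _ => ?_)
    rw [← he y.1 y rfl]
    exact N.smul_mem _ hen
  · refine ⟨fun h => ?_, fun N hN => eq_top_iff.2 fun y _ => ?_⟩
    · have : e ∈ LinearMap.ker (Ptilde.toS k B P₀) := h ▸ Submodule.mem_top
      exact one_ne_zero (α := k) this
    · obtain ⟨n, hn, hnk⟩ := Set.exists_of_ssubset hN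
      have hc : n.1.c ≠ 0 := hnk
      have hen : e - (⟨0, 0, n.1.c⁻¹⟩ : OnePointExt k B P₀) • n ∈ N := by
        apply hN.le
        change (e - (⟨0, 0, n.1.c⁻¹⟩ : OnePointExt k B P₀) • n).1.c = 0
        rw [sub_eq_add_neg]
        change (1 : k) + -(n.1.c⁻¹ * n.1.c) = 0
        rw [inv_mul_cancel₀ hc, add_neg_cancel]
      have hee : e ∈ N := by
        have := N.add_mem hen (N.smul_mem (⟨0, 0, n.1.c⁻¹⟩ : OnePointExt k B P₀) hn)
        rwa [sub_add_cancel] at this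
      rw [← he y.1 y rfl]
      exact N.smul_mem _ hee

end CosiltingExt

/-!
Write `A = B[P₀]` and let `e_B`, `e = 1 - e_B` be the two diagonal idempotents. The restriction `𝓡`
amounts to `X ↦ e_B X`. It has a right adjoint, the extension functor `𝓔`, and also a left adjoint,
the inflation functor along the ring homomorphism `A → B`, `(b p; 0 c) ↦ b`. Both `𝓡` and inflation
preserve monomorphisms, so `𝓔` and `𝓡` preserve injective modules; being right adjoints they are
left exact. Hence both carry injective copresentations to injective copresentations, and the two
adjunctions translate the surjectivity of `Hom(-, ζ)`:

* `M ∈ 𝓑_{𝓡 ζ}` iff the inflation of `M` lies in `𝓑_ζ` (`memB_restrMap_iff`);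
* `X ∈ 𝓑_{𝓔 ζ}` iff `𝓡 X ∈ 𝓑_ζ` (`memB_extnMap_iff`).

The same adjunctions translate cogeneration, read as separation of points by homomorphisms
(`memCogen_iff`). A homomorphism from the inflation of `M` to `C` does not kill `m` iff the adjoint
map `M → 𝓡 C` does not, so `M` is cogenerated by `𝓡 C` iff its inflation is cogenerated by `C`; this
gives the descent of cosilting modules (`IsCosiltingWith.restr`). Conversely, `X` is cogenerated by
`𝓔 C' ⊕ S` iff `𝓡 X` is cogenerated by `C'` (`memCogen_extn_prod_simpleS_iff`): an element `x` with
`e x ≠ 0` is detected by a map to `S`, since `k`-linear functionals on `e X` are the same as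
`A`-linear maps `X → S`, and an element with `e x = 0` lies in `e_B X`. The description of
`Hom_A(X, S)` also shows that `S` is injective, and the summand `S` does not affect `𝓑`
because `ζ` vanishes on it.
-/

namespace CosiltingExt

open OnePointExt

/-! ### Cogeneration and injective modules -/

/-- A module is cogenerated by `T` iff homomorphisms to `T` separate its points from zero. -/
theorem memCogen_iff {R : Type u} [Ring R] {T M : Type u} [AddCommGroup T] [Module R T]
    [AddCommGroup M] [Module R M] :
    MemCogen R T M ↔ ∀ m : M, m ≠ 0 → ∃ f : M →ₗ[R] T, f m ≠ 0 := by
  constructor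
  · rintro ⟨I, f, hf⟩ m hm
    by_contra! h
    exact hm (hf (by
      rw [map_zero]
      exact funext fun i => h (LinearMap.proj i ∘ₗ f)))
  · intro h
    refine ⟨M →ₗ[R] T, LinearMap.pi fun f => f, (injective_iff_map_eq_zero _).2 fun m hm => ?_⟩
    by_contra hne
    obtain ⟨f, hf⟩ := h m hne
    exact hf (congrFun hm f)

theorem injective_prod {R : Type u} [Ring R] {M N : Type u} [AddCommGroup M] [Module R M]
    [AddCommGroup N] [Module R N] (hM : Module.Injective R M) (hN : Module.Injective R N) :
    Module.Injective R (M × N) where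
  out X Y _ _ _ _ f hf g := by
    obtain ⟨h₁, hh₁⟩ := hM.out f hf (LinearMap.fst R M N ∘ₗ g)
    obtain ⟨h₂, hh₂⟩ := hN.out f hf (LinearMap.snd R M N ∘ₗ g)
    exact ⟨h₁.prod h₂, fun x => Prod.ext (hh₁ x) (hh₂ x)⟩

/-- A summand of the domain on which the map vanishes does not change `𝓑`. -/
theorem memB_coprod_zero_iff {R : Type u} [Ring R] {E₀ E₁ S M : Type u} [AddCommGroup E₀]
    [Module R E₀] [AddCommGroup E₁] [Module R E₁] [AddCommGroup S] [Module R S] [AddCommGroup M]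
    [Module R M] (ζ : E₀ →ₗ[R] E₁) :
    MemB (ζ.coprod (0 : S →ₗ[R] E₁)) M ↔ MemB ζ M := by
  constructor
  · intro h g
    obtain ⟨f, hf⟩ := h g
    refine ⟨LinearMap.fst R E₀ S ∘ₗ f, ?_⟩
    rw [← hf]
    ext m
    simp
  · intro h g
    obtain ⟨f, hf⟩ := h g
    refine ⟨f.prod 0, ?_⟩
    rw [← hf]
    ext m
    simp

variable {k B P₀ : Type u} [Field k] [Ring B] [Algebra k B] [AddCommGroup P₀] [Module B P₀]

/-! ### The restriction functor -/

section Restr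

variable {X Y Z : Type u} [AddCommGroup X] [Module (OnePointExt k B P₀) X]
  [AddCommGroup Y] [Module (OnePointExt k B P₀) Y]
  [AddCommGroup Z] [Module (OnePointExt k B P₀) Z]

theorem eB_mul_eB : eB k B P₀ * eB k B P₀ = eB k B P₀ := eB_mul_ofB 1

theorem mul_eB (a : OnePointExt k B P₀) : a * eB k B P₀ = ofB k P₀ a.b := by
  ext <;> simp [eB]

/-- The value of an element of `𝓡 X = Hom_A(A e_B, X)` at the generator `e_B`. It identifies
`𝓡 X` with `e_B X`. -/
def Restr.val : Restr k B P₀ X →+ X where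
  toFun f := (show AeB k B P₀ →ₗ[OnePointExt k B P₀] X from f)
    ⟨eB k B P₀, mem_AeB.2 eB_mul_eB⟩
  map_zero' := rfl
  map_add' _ _ := rfl

/-- The element `z ↦ z x` of `𝓡 X = Hom_A(A e_B, X)`; it corresponds to `e_B x`. -/
def Restr.mk (x : X) : Restr k B P₀ X :=
  (LinearMap.toSpanSingleton (OnePointExt k B P₀) X x).comp (AeB k B P₀).subtype

theorem Restr.apply_eq (f : AeB k B P₀ →ₗ[OnePointExt k B P₀] X) (z : AeB k B P₀) :
    f z = z.1 • Restr.val (k := k) (B := B) (P₀ := P₀) f := by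
  change f z = z.1 • f _
  rw [← map_smul]
  exact congrArg f (Subtype.ext (mem_AeB.1 z.2).symm)

@[ext]
theorem Restr.ext {f g : Restr k B P₀ X} (h : Restr.val f = Restr.val g) : f = g :=
  LinearMap.ext fun z => by rw [Restr.apply_eq f, Restr.apply_eq g, h]

@[simp]
theorem Restr.val_mk (x : X) : Restr.val (Restr.mk (k := k) (B := B) (P₀ := P₀) x) =
    eB k B P₀ • x := rfl

@[simp]
theorem Restr.val_smul (b : B) (f : Restr k B P₀ X) :
    Restr.val (b • f) = ofB k P₀ b • Restr.val f := by
  refine (Restr.apply_eq f _).trans ?_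
  change (eB k B P₀ * ofB k P₀ b) • _ = _
  rw [eB_mul_ofB]

@[simp]
theorem Restr.eB_smul_val (f : Restr k B P₀ X) : eB k B P₀ • Restr.val f = Restr.val f :=
  (Restr.apply_eq f ⟨eB k B P₀, mem_AeB.2 eB_mul_eB⟩).symm

@[simp]
theorem Restr.mk_val (f : Restr k B P₀ X) : Restr.mk (Restr.val f) = f := by
  ext
  simp

/-- The functor `𝓡` on morphisms: composition with `g`. -/
def Restr.map (g : X →ₗ[OnePointExt k B P₀] Y) : Restr k B P₀ X →ₗ[B] Restr k B P₀ Y where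
  toFun f := LinearMap.comp (M₂ := X) g f
  map_add' _ _ := LinearMap.comp_add _ _ _
  map_smul' _ _ := rfl

@[simp]
theorem Restr.val_map (g : X →ₗ[OnePointExt k B P₀] Y) (f : Restr k B P₀ X) :
    Restr.val (Restr.map g f) = g (Restr.val f) := rfl

theorem Restr.map_injective {g : X →ₗ[OnePointExt k B P₀] Y} (hg : Function.Injective g) :
    Function.Injective (Restr.map g) := fun f f' h => by
  ext
  exact hg (congrArg Restr.val h)

theorem Restr.map_exact {f : X →ₗ[OnePointExt k B P₀] Y} {g : Y →ₗ[OnePointExt k B P₀] Z}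
    (h : Function.Exact f g) : Function.Exact (Restr.map f) (Restr.map g) := by
  intro y
  constructor
  · intro hy
    obtain ⟨x, hx⟩ := (h (Restr.val y)).1 (congrArg Restr.val hy)
    refine ⟨Restr.mk x, ?_⟩
    ext
    simp [hx]
  · rintro ⟨x, rfl⟩
    ext
    exact h.apply_apply_eq_zero _

end Restr

/-! ### Inflation and the descent of cosilting modules -/

section Infl

/-- The ring homomorphism `A → B`, `(b p; 0 c) ↦ b`. -/
def OnePointExt.toB : OnePointExt k B P₀ →+* B where
  toFun x := x.b
  map_one' := rfl
  map_mul' _ _ := rfl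
  map_zero' := rfl
  map_add' _ _ := rfl

/-- The inflation of a `B`-module `M`: the abelian group `M`, on which `A` acts through `A → B`. It
is a type synonym, so that elements and maps pass between `M` and its inflation by definitional
unfolding. -/
@[nolint unusedArguments]
def Infl (k B P₀ : Type u) [Field k] [Ring B] [Algebra k B] [AddCommGroup P₀] [Module B P₀]
    (M : Type u) : Type u := M

variable {M N : Type u} [AddCommGroup M] [Module B M] [AddCommGroup N] [Module B N]

instance : AddCommGroup (Infl k B P₀ M) := inferInstanceAs (AddCommGroup M)

instance : Module (OnePointExt k B P₀) (Infl k B P₀ M) :=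
  Module.compHom M (OnePointExt.toB (k := k) (B := B) (P₀ := P₀))

variable (k P₀) in
/-- Inflation on morphisms. -/
def Infl.map (g : M →ₗ[B] N) : Infl k B P₀ M →ₗ[OnePointExt k B P₀] Infl k B P₀ N where
  toFun m := g m
  map_add' := g.map_add
  map_smul' a := g.map_smul a.b

variable {X Y : Type u} [AddCommGroup X] [Module (OnePointExt k B P₀) X]
  [AddCommGroup Y] [Module (OnePointExt k B P₀) Y]

/-- Inflation is left adjoint to the restriction functor `𝓡`. -/
def inflAdj : (Infl k B P₀ M →ₗ[OnePointExt k B P₀] X) ≃ (M →ₗ[B] Restr k B P₀ X) where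
  toFun g :=
    { toFun := fun m => Restr.mk (g m)
      map_add' := fun m m' => by
        ext
        simp only [Restr.val_mk, map_add, ← smul_add]
        exact congrArg _ (g.map_add m m')
      map_smul' := fun b m => by
        ext
        simp only [Restr.val_mk, Restr.val_smul, RingHom.id_apply, smul_smul, ofB_mul_eB]
        rw [← eB_mul_ofB, mul_smul]
        exact congrArg _ (g.map_smul (ofB k P₀ b) m) }
  invFun h :=
    { toFun := fun m => Restr.val (h m)
      map_add' := fun m m' => (congrArg Restr.val (h.map_add m m')).trans (map_add _ _ _)
      map_smul' := fun a m => by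
        refine (congrArg Restr.val (h.map_smul a.b m)).trans ?_
        rw [Restr.val_smul, ← mul_eB, mul_smul, Restr.eB_smul_val, RingHom.id_apply] }
  left_inv g := LinearMap.ext fun m => by
    change eB k B P₀ • g m = g m
    rw [← map_smul]
    exact congrArg g (one_smul B (show M from m))
  right_inv h := LinearMap.ext fun m => Restr.mk_val (h m)

theorem inflAdj_symm_apply (h : M →ₗ[B] Restr k B P₀ X) (m : M) :
    inflAdj.symm h m = Restr.val (h m) := rfl

theorem inflAdj_comp (ζ : X →ₗ[OnePointExt k B P₀] Y)
    (g : Infl k B P₀ M →ₗ[OnePointExt k B P₀] X) :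
    inflAdj (ζ ∘ₗ g) = Restr.map ζ ∘ₗ inflAdj g := LinearMap.ext fun m => by
  ext
  exact (ζ.map_smul _ _).symm

theorem injective_restr (hX : Module.Injective (OnePointExt k B P₀) X) :
    Module.Injective B (Restr k B P₀ X) where
  out M N _ _ _ _ f hf g := by
    obtain ⟨h, hh⟩ := hX.out (Infl.map k P₀ f) hf (inflAdj.symm g)
    refine ⟨inflAdj h, fun m => ?_⟩
    ext
    change eB k B P₀ • h (f m) = _
    exact (congrArg _ (hh m)).trans (Restr.eB_smul_val (g m))

theorem memB_restrMap_iff (ζ : X →ₗ[OnePointExt k B P₀] Y) :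
    MemB (Restr.map ζ) M ↔ MemB ζ (Infl k B P₀ M) := by
  constructor
  · intro h g
    obtain ⟨f, hf⟩ := h (inflAdj g)
    refine ⟨inflAdj.symm f, inflAdj.injective ?_⟩
    rw [inflAdj_comp, Equiv.apply_symm_apply]
    exact hf
  · intro h g
    obtain ⟨f, hf⟩ := h (inflAdj.symm g)
    refine ⟨inflAdj f, inflAdj.symm.injective ?_⟩
    refine (congrArg inflAdj.symm (inflAdj_comp ζ f).symm).trans ?_
    rwa [Equiv.symm_apply_apply]

theorem memCogen_restr_iff :
    MemCogen B (Restr k B P₀ X) M ↔ MemCogen (OnePointExt k B P₀) X (Infl k B P₀ M) := by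
  rw [memCogen_iff, memCogen_iff]
  have key (h : M →ₗ[B] Restr k B P₀ X) (m : M) : h m ≠ 0 ↔ inflAdj.symm h m ≠ 0 := by
    rw [inflAdj_symm_apply]
    exact not_congr ⟨fun h0 => h0 ▸ map_zero _, fun h0 => Restr.ext (h0.trans (map_zero _).symm)⟩
  refine forall_congr' fun m => imp_congr Iff.rfl ⟨?_, ?_⟩
  · rintro ⟨h, hm⟩
    exact ⟨_, (key h m).1 hm⟩
  · rintro ⟨g, hm⟩
    refine ⟨inflAdj g, (key _ m).2 ?_⟩
    rwa [Equiv.symm_apply_apply]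

/-- The restriction of a cosilting module is cosilting. -/
theorem IsCosiltingWith.restr {C E₀ E₁ : Type u} [AddCommGroup C]
    [Module (OnePointExt k B P₀) C] [AddCommGroup E₀] [Module (OnePointExt k B P₀) E₀]
    [AddCommGroup E₁] [Module (OnePointExt k B P₀) E₁] {ι : C →ₗ[OnePointExt k B P₀] E₀}
    {ζ : E₀ →ₗ[OnePointExt k B P₀] E₁} (h : IsCosiltingWith ι ζ) :
    IsCosiltingWith (Restr.map ι) (Restr.map ζ) where
  copresentation :=
    { injective₀ := injective_restr h.copresentation.injective₀
      injective₁ := injective_restr h.copresentation.injective₁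
      mono := Restr.map_injective h.copresentation.mono
      exact := Restr.map_exact h.copresentation.exact }
  cogen_iff M _ _ := by
    rw [memCogen_restr_iff, memB_restrMap_iff]
    exact h.cogen_iff _

end Infl

/-! ### The extension functor -/

section Extn

variable {M N L : Type u} [AddCommGroup M] [Module B M] [AddCommGroup N] [Module B N]
  [AddCommGroup L] [Module B L]

theorem extnMap_injective {g : M →ₗ[B] N} (hg : Function.Injective g) :
    Function.Injective (Extn.map k P₀ g) := fun _ _ h =>
  LinearMap.ext fun y => hg (LinearMap.congr_fun (M := eBA k B P₀) h y)

theorem extnMap_exact {f : M →ₗ[B] N} {g : N →ₗ[B] L} (hf : Function.Injective f)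
    (h : Function.Exact f g) : Function.Exact (Extn.map k P₀ f) (Extn.map k P₀ g) := by
  intro y
  constructor
  · intro hy
    -- A map killed by `g` takes values in the range of `f`, hence lifts along `f`.
    have hr : ∀ z, (show eBA k B P₀ →ₗ[B] N from y) z ∈ LinearMap.range f := fun z =>
      (h _).1 (LinearMap.congr_fun (M := eBA k B P₀) hy z)
    refine ⟨(LinearEquiv.ofInjective f hf).symm.toLinearMap ∘ₗ
      LinearMap.codRestrict (LinearMap.range f) (show eBA k B P₀ →ₗ[B] N from y) hr, ?_⟩
    exact LinearMap.ext fun z =>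
      congrArg Subtype.val ((LinearEquiv.ofInjective f hf).apply_symm_apply ⟨_, hr z⟩)
  · rintro ⟨x, rfl⟩
    exact LinearMap.ext fun z => h.apply_apply_eq_zero _

variable {X Y : Type u} [AddCommGroup X] [Module (OnePointExt k B P₀) X]
  [AddCommGroup Y] [Module (OnePointExt k B P₀) Y]

/-- The value of an element of `𝓔 M = Hom_B(e_B A, M)` at the idempotent `e_B`. -/
def Extn.evalEB : Extn k B P₀ M →+ M where
  toFun f := (show eBA k B P₀ →ₗ[B] M from f) ⟨eB k B P₀, mem_eBA.2 eB_mul_eB⟩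
  map_zero' := rfl
  map_add' _ _ := rfl

/-- Under the identification of `𝓔 M` with `Hom_B(e_B A, M)`, the value of `f` at `y` is that of
`y f` at `e_B`. -/
theorem Extn.apply_eq (f : eBA k B P₀ →ₗ[B] M) (y : eBA k B P₀) :
    f y = Extn.evalEB (y.1 • (show Extn k B P₀ M from f)) :=
  congrArg f (Subtype.ext (mem_eBA.1 y.2).symm)

theorem Extn.evalEB_ofB_smul (b : B) (f : Extn k B P₀ M) :
    Extn.evalEB (ofB k P₀ b • f) = b • Extn.evalEB f := by
  refine Eq.trans ?_ (LinearMap.map_smul (show eBA k B P₀ →ₗ[B] M from f) b _)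
  refine congrArg (show eBA k B P₀ →ₗ[B] M from f) (Subtype.ext ?_)
  change eB k B P₀ * ofB k P₀ b = ofB k P₀ b * eB k B P₀
  rw [eB_mul_ofB, ofB_mul_eB]

/-- An element of `e_B 𝓔 M` is determined by its value at `e_B`. -/
theorem Extn.eq_zero_of_eB_smul {f : Extn k B P₀ M} (he : eB k B P₀ • f = f)
    (h0 : Extn.evalEB f = 0) : f = 0 := LinearMap.ext fun y => by
  rw [Extn.apply_eq (M := M) f y]
  change Extn.evalEB (y.1 • f) = 0
  rw [← he, smul_smul, mul_eB, Extn.evalEB_ofB_smul, h0, smul_zero]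

/-- The extension functor `𝓔` is right adjoint to the restriction functor `𝓡`. -/
def extnAdj : (Restr k B P₀ X →ₗ[B] M) ≃ (X →ₗ[OnePointExt k B P₀] Extn k B P₀ M) where
  toFun h :=
    { toFun := fun x =>
        ({ toFun := fun y => h (Restr.mk (y.1 • x))
           map_add' := fun y y' => by
             rw [← map_add]
             congr 1
             ext
             simp [add_smul]
           map_smul' := fun b y => by
             rw [RingHom.id_apply, ← map_smul]
             congr 1
             ext
             simp only [Restr.val_mk, Restr.val_smul, coe_smul_eBA, smul_smul, ← mul_assoc,
               ofB_mul_eB, eB_mul_ofB] } : eBA k B P₀ →ₗ[B] M)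
      map_add' := fun x x' => LinearMap.ext fun y => by
        refine Eq.trans ?_ (h.map_add _ _)
        refine congrArg h (Restr.ext ?_)
        simp
      map_smul' := fun a x => LinearMap.ext fun y =>
        congrArg (fun z => h (Restr.mk z)) (smul_smul y.1 a x) }
  invFun g :=
    { toFun := fun f => Extn.evalEB (g (Restr.val f))
      map_add' := fun f f' => by simp
      map_smul' := fun b f => by
        rw [Restr.val_smul, map_smul, Extn.evalEB_ofB_smul, RingHom.id_apply] }
  left_inv h := LinearMap.ext fun f => by
    change h (Restr.mk (eB k B P₀ • Restr.val f)) = h f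
    rw [Restr.eB_smul_val, Restr.mk_val]
  right_inv g := LinearMap.ext fun x => LinearMap.ext fun y => by
    rw [Extn.apply_eq (M := M) (g x) y]
    change Extn.evalEB (g (eB k B P₀ • y.1 • x)) = _
    rw [smul_smul, mem_eBA.1 y.2, map_smul]

theorem evalEB_extnAdj (h : Restr k B P₀ X →ₗ[B] M) (x : X) :
    Extn.evalEB (extnAdj h x) = h (Restr.mk x) := by
  change h (Restr.mk (eB k B P₀ • x)) = _
  congr 1
  ext
  simp [smul_smul, eB_mul_eB]

theorem extnAdj_comp (ζ : M →ₗ[B] N) (h : Restr k B P₀ X →ₗ[B] M) :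
    extnAdj (ζ ∘ₗ h) = Extn.map k P₀ ζ ∘ₗ extnAdj h := rfl

theorem extnAdj_comp_map (f : X →ₗ[OnePointExt k B P₀] Y) (h : Restr k B P₀ Y →ₗ[B] M) :
    extnAdj (h ∘ₗ Restr.map f) = extnAdj h ∘ₗ f := by
  apply extnAdj.symm.injective
  rw [Equiv.symm_apply_apply]
  refine LinearMap.ext fun z => ?_
  change h (Restr.map f z) = Extn.evalEB (extnAdj h (f (Restr.val z)))
  rw [evalEB_extnAdj, ← Restr.val_map, Restr.mk_val]

theorem injective_extn (hM : Module.Injective B M) :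
    Module.Injective (OnePointExt k B P₀) (Extn k B P₀ M) where
  out X Y _ _ _ _ f hf g := by
    obtain ⟨h, hh⟩ := hM.out (Restr.map f) (Restr.map_injective hf) (extnAdj.symm g)
    refine ⟨extnAdj h, fun x => ?_⟩
    have : h ∘ₗ Restr.map f = extnAdj.symm g := LinearMap.ext hh
    rw [← LinearMap.comp_apply, ← extnAdj_comp_map, this, Equiv.apply_symm_apply]

theorem memB_extnMap_iff (ζ : M →ₗ[B] N) :
    MemB (Extn.map k P₀ ζ) X ↔ MemB ζ (Restr k B P₀ X) := by
  constructor
  · intro h g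
    obtain ⟨f, hf⟩ := h (extnAdj g)
    refine ⟨extnAdj.symm f, extnAdj.injective ?_⟩
    rw [extnAdj_comp, Equiv.apply_symm_apply]
    exact hf
  · intro h g
    obtain ⟨f, hf⟩ := h (extnAdj.symm g)
    refine ⟨extnAdj f, extnAdj.symm.injective ?_⟩
    refine (congrArg extnAdj.symm (extnAdj_comp ζ f).symm).trans ?_
    rwa [Equiv.symm_apply_apply]

end Extn

/-! ### The simple injective module `S` -/

section SimpleS

/-- The ring homomorphism `k → A` that sends `c` to the scalar matrix `(c 0; 0 c)`. -/
def OnePointExt.scalar : k →+* OnePointExt k B P₀ where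
  toFun c := ⟨algebraMap k B c, 0, c⟩
  map_one' := by ext <;> simp
  map_mul' c d := by ext <;> simp
  map_zero' := by ext <;> simp
  map_add' c d := by ext <;> simp

variable (k B P₀) in
/-- The idempotent `e = (0 0; 0 1)`. -/
def OnePointExt.eTop : OnePointExt k B P₀ := ⟨0, 0, 1⟩

theorem eTop_mul (a : OnePointExt k B P₀) :
    eTop k B P₀ * a = scalar a.c * eTop k B P₀ := by
  ext <;> simp [eTop, scalar]

theorem eB_add_eTop : eB k B P₀ + eTop k B P₀ = 1 := by
  ext <;> simp [eTop, eB]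

theorem eTop_smul_simpleS (s : SimpleS k B P₀) : eTop k B P₀ • s = s := one_mul (M := k) s

theorem eB_smul_simpleS (s : SimpleS k B P₀) : eB k B P₀ • s = 0 := zero_mul (M₀ := k) s

variable {X Y : Type u} [AddCommGroup X] [Module (OnePointExt k B P₀) X]
  [AddCommGroup Y] [Module (OnePointExt k B P₀) Y]

/-- The `A`-linear map `x ↦ φ (e x)` from `X` to `S` given by a `k`-linear functional `φ` on `X`,
for the `k`-module structure of `X` by scalar matrices. -/
def toSimpleS [Module k X]
    (hk : ∀ (c : k) (x : X), c • x = (scalar c : OnePointExt k B P₀) • x) (φ : X →ₗ[k] k) :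
    X →ₗ[OnePointExt k B P₀] SimpleS k B P₀ where
  toFun x := φ (eTop k B P₀ • x)
  map_add' x y := by
    rw [smul_add]
    exact map_add _ _ _
  map_smul' a x := by
    rw [smul_smul, eTop_mul, mul_smul, ← hk, map_smul]
    rfl

theorem injective_simpleS : Module.Injective (OnePointExt k B P₀) (SimpleS k B P₀) where
  out X Y _ _ _ _ f hf g := by
    let _ : Module k X := Module.compHom X (scalar : k →+* OnePointExt k B P₀)
    let _ : Module k Y := Module.compHom Y (scalar : k →+* OnePointExt k B P₀)
    let f' : X →ₗ[k] Y := ⟨f.toAddHom, fun c x => f.map_smul (scalar c) x⟩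
    let g' : X →ₗ[k] k := ⟨g.toAddHom, fun c x => g.map_smul (scalar c) x⟩
    obtain ⟨r, hr⟩ := f'.exists_leftInverse_of_injective (LinearMap.ker_eq_bot.2 hf)
    refine ⟨toSimpleS (fun _ _ => rfl) (g' ∘ₗ r), fun x => ?_⟩
    change g' (r (eTop k B P₀ • f x)) = g x
    rw [← map_smul]
    refine (congrArg g' (LinearMap.congr_fun hr (eTop k B P₀ • x))).trans ?_
    exact (g.map_smul _ x).trans (eTop_smul_simpleS _)

/-- Maps to `S` detect the elements `x` with `e x ≠ 0`. -/
theorem exists_toSimpleS_ne_zero {x : X} (hx : eTop k B P₀ • x ≠ 0) :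
    ∃ g : X →ₗ[OnePointExt k B P₀] SimpleS k B P₀, g x ≠ 0 := by
  let _ : Module k X := Module.compHom X (scalar : k →+* OnePointExt k B P₀)
  by_contra! h
  exact hx ((Module.forall_dual_apply_eq_zero_iff k _).1 fun φ =>
    h (toSimpleS (fun _ _ => rfl) φ))

/-- `Cogen(𝓔 C ⊕ S)` consists of the `A`-modules whose restriction lies in `Cogen(C)`. -/
theorem memCogen_extn_prod_simpleS_iff {C : Type u} [AddCommGroup C] [Module B C] :
    MemCogen (OnePointExt k B P₀) (Extn k B P₀ C × SimpleS k B P₀) X ↔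
      MemCogen B C (Restr k B P₀ X) := by
  rw [memCogen_iff, memCogen_iff]
  constructor
  · intro h z hz
    have hz' : Restr.val z ≠ 0 := fun h0 => hz (Restr.ext (h0.trans (map_zero _).symm))
    obtain ⟨g, hg⟩ := h _ hz'
    -- The value of `g` is fixed by `e_B`, so its component in `S` vanishes.
    have he : eB k B P₀ • g (Restr.val z) = g (Restr.val z) := by
      rw [← map_smul, Restr.eB_smul_val]
    have h₂ : (g (Restr.val z)).2 = 0 := by
      rw [← he]
      exact eB_smul_simpleS _
    refine ⟨extnAdj.symm (LinearMap.fst _ _ _ ∘ₗ g), fun h0 => hg (Prod.ext ?_ h₂)⟩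
    -- The component in `𝓔 C` is fixed by `e_B` as well, so its value at `e_B` determines it.
    exact Extn.eq_zero_of_eB_smul (congrArg Prod.fst he) h0
  · intro h x hx
    by_cases hxe : eTop k B P₀ • x = 0
    · have hxB : eB k B P₀ • x = x := by
        have := add_smul (eB k B P₀) (eTop k B P₀) x
        rwa [eB_add_eTop, one_smul, hxe, add_zero, eq_comm] at this
      obtain ⟨φ, hφ⟩ := h (Restr.mk x) fun h0 => hx (by
        rw [← hxB, ← Restr.val_mk, h0, map_zero])
      refine ⟨(extnAdj φ).prod 0, fun h0 => hφ ?_⟩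
      rw [← evalEB_extnAdj]
      exact (congrArg Extn.evalEB (congrArg Prod.fst h0)).trans (map_zero _)
    · obtain ⟨g, hg⟩ := exists_toSimpleS_ne_zero hxe
      exact ⟨LinearMap.prod 0 g, fun h0 => hg (congrArg Prod.snd h0)⟩

/-- If `C` is cosilting over `B`, then `𝓔 C ⊕ S` is cosilting over the one-point extension. -/
theorem IsCosiltingWith.extn_prod_simpleS {C E₀ E₁ : Type u} [AddCommGroup C] [Module B C]
    [AddCommGroup E₀] [Module B E₀] [AddCommGroup E₁] [Module B E₁] {ι : C →ₗ[B] E₀}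
    {ζ : E₀ →ₗ[B] E₁} (h : IsCosiltingWith ι ζ) :
    IsCosiltingWith
      ((Extn.map k P₀ ι).prodMap
        (LinearMap.id : SimpleS k B P₀ →ₗ[OnePointExt k B P₀] SimpleS k B P₀))
      ((Extn.map k P₀ ζ).coprod (0 : SimpleS k B P₀ →ₗ[OnePointExt k B P₀] Extn k B P₀ E₁)) where
  copresentation :=
    { injective₀ := injective_prod (injective_extn h.copresentation.injective₀) injective_simpleS
      injective₁ := injective_extn h.copresentation.injective₁
      mono := (extnMap_injective h.copresentation.mono).prodMap Function.injective_id
      exact := by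
        have hex := extnMap_exact (k := k) (P₀ := P₀) h.copresentation.mono h.copresentation.exact
        rintro ⟨y, s⟩
        simp only [LinearMap.coprod_apply, LinearMap.zero_apply, add_zero, hex y, Set.mem_range,
          Prod.exists, LinearMap.prodMap_apply, LinearMap.id_apply, Prod.mk.injEq]
        exact ⟨fun ⟨x, hx⟩ => ⟨x, s, hx, rfl⟩, fun ⟨x, _, hx, _⟩ => ⟨x, hx⟩⟩ }
  cogen_iff X _ _ := by
    rw [memCogen_extn_prod_simpleS_iff, memB_coprod_zero_iff, memB_extnMap_iff]
    exact h.cogen_iff _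

end SimpleS

end CosiltingExt

/-- Let `k` be an algebraically closed field, `B` a finite dimensional `k`-algebra, `P₀` a finitely
generated projective `B`-module, and `A = B[P₀]` the one-point extension. -/
theorem mainTheorem5 (k B P₀ : Type u) [Field k] [IsAlgClosed k] [Ring B] [Algebra k B]
    [Module.Finite k B] [AddCommGroup P₀] [Module B P₀] [Module.Finite B P₀]
    [Module.Projective B P₀] :
    -- If `C ∈ S^perp` is a cosilting `A`-module, then `𝓡 C` is a cosilting `B`-module.
    (∀ (C : Type u) [AddCommGroup C] [Module (CosiltingExt.OnePointExt k B P₀) C],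
      CosiltingExt.MemPerp (CosiltingExt.OnePointExt k B P₀) (CosiltingExt.SimpleS k B P₀) C →
      CosiltingExt.IsCosilting (CosiltingExt.OnePointExt k B P₀) C →
      CosiltingExt.IsCosilting B (CosiltingExt.Restr k B P₀ C)) ∧
    -- If `C'` is a cosilting `B`-module, then `𝓔 C' ⊕ S` is a cosilting `A`-module.
    (∀ (C' : Type u) [AddCommGroup C'] [Module B C'],
      CosiltingExt.IsCosilting B C' →
      CosiltingExt.IsCosilting (CosiltingExt.OnePointExt k B P₀)
        (CosiltingExt.Extn k B P₀ C' × CosiltingExt.SimpleS k B P₀)) ∧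
    -- More precisely, if `C'` is cosilting with respect to `0 → C' → E₀ → E₁` with maps `ι`, `ζ`, then
    -- `𝓔 C' ⊕ S` is cosilting with respect to
    -- `0 → 𝓔 C' ⊕ S → 𝓔 E₀ ⊕ S → 𝓔 E₁` with maps `𝓔 ι ⊕ 1`, `(𝓔 ζ  0)`.
    (∀ (C' E₀ E₁ : Type u) [AddCommGroup C'] [Module B C'] [AddCommGroup E₀] [Module B E₀]
      [AddCommGroup E₁] [Module B E₁] (ι : C' →ₗ[B] E₀) (ζ : E₀ →ₗ[B] E₁),
      CosiltingExt.IsCosiltingWith ι ζ →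
      CosiltingExt.IsCosiltingWith
        (LinearMap.prodMap (CosiltingExt.Extn.map k P₀ ι)
          (LinearMap.id :
            CosiltingExt.SimpleS k B P₀ →ₗ[CosiltingExt.OnePointExt k B P₀]
              CosiltingExt.SimpleS k B P₀))
        (LinearMap.coprod (CosiltingExt.Extn.map k P₀ ζ)
          (0 : CosiltingExt.SimpleS k B P₀ →ₗ[CosiltingExt.OnePointExt k B P₀]
            CosiltingExt.Extn k B P₀ E₁))) := by
  refine ⟨?_, ?_, fun _ _ _ _ _ _ _ _ _ ι ζ h => h.extn_prod_simpleS⟩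
  · rintro C _ _ - ⟨_, _, _, _, _, _, ι, ζ, h⟩
    exact ⟨_, _, _, _, _, _, _, _, h.restr⟩
  · rintro C' _ _ ⟨_, _, _, _, _, _, ι, ζ, h⟩
    exact ⟨_, _, _, _, _, _, _, _, h.extn_prod_simpleS⟩
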